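/- Theorem 2 (Hessian Sampling Bound). Let $f=\frac1n\sum_{i=1}^n f_i$ with $n\ge 1$, where every $f_i:\mathbb{R}^d\to\mathbb{R}$ is twice differentiable and every gradient $\nabla f_i$ is Lipschitz continuous with constant $L_1$ with respect to the Euclidean norm. Let $\epsilon_{\mathbf B}>0$ and $\delta\in(0,1)$. Let $(\mathbf x_t)_{t\ge0}$ be (possibly random) iterates in $\mathbb{R}^d$. At each iteration $t\ge 0$ let a batch $\mathcal S_{\mathbf B,t}$ of $|\mathcal S_{\mathbf B,t}|$ indices be drawn independently and uniformly (with replacement) from $\{1,\dots,n\}$, independently of the iterate $\mathbf x_t$, and let $$\mathbf B_t=\frac1{|\mathcal S_{\mathbf B,t}|}\sum_{i\in\mathcal S_{\mathbf B,t}}\nabla^2 f_i(\mathbf x_t),\qquad \mathbf H(\mathbf x_t)=\nabla^2 f(\mathbf x_t),$$ where the sum and the size $|\mathcal S_{\mathbf B,t}|$ count repeated indices with multiplicity. Then for every $t\ge0$: if $$|\mathcal S_{\mathbf B,t}|\ \ge\ \frac{16L_1^2\log(2d/\delta)}{\epsilon_{\mathbf B}^2},$$ then, with probability at least $1-\delta$,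 $$\|\mathbf B_t-\mathbf H(\mathbf x_t)\|\le\epsilon_{\mathbf B}$$ in the operator norm induced by the Euclidean norm. -/

import Mathlib

open MeasureTheory ProbabilityTheory
open scoped NNReal ENNReal

noncomputable section

namespace HessianSampling

/-- `ℝᵈ` with the Euclidean norm. -/
abbrev Space (d : ℕ) : Type := EuclideanSpace ℝ (Fin d)

/-- The function `f` is twice differentiable on all of `ℝᵈ`. -/
def TwiceDifferentiable {d : ℕ} (f : Space d → ℝ) : Prop :=
  Differentiable ℝ f ∧ Differentiable ℝ (gradient f)

/-- The Hessian `∇²f(x)`, the derivative of the gradient, as a linear operator on `ℝᵈ`;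
its norm is the operator norm for the Euclidean norm. -/
def hessian {d : ℕ} (f : Space d → ℝ) (x : Space d) : Space d →L[ℝ] Space d :=
  fderiv ℝ (gradient f) x

/-- The finite-sum objective `f(x) = (1/n) ∑ᵢ fᵢ(x)`. -/
def objective {n d : ℕ} (f : Fin n → Space d → ℝ) (x : Space d) : ℝ :=
  (1 / (n : ℝ)) * ∑ i, f i x

/-- The mini-batch Hessian estimator `B(x) = (1/|S|) ∑_{i ∈ S} ∇²fᵢ(x)`, where the batch `S`
consists of the `m` drawn indices `S 0, …, S (m - 1)`, counted with multiplicity. -/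
def batchHessian {n d m : ℕ} (f : Fin n → Space d → ℝ) (S : Fin m → Fin n) (x : Space d) :
    Space d →L[ℝ] Space d :=
  (1 / (m : ℝ)) • ∑ j, hessian (f (S j)) x

/-- A random batch of `m` data points drawn independently and uniformly from the `n` data points. -/
structure IsUniformBatch {Ω : Type*} [MeasurableSpace Ω] (P : Measure Ω) {n m : ℕ}
    (S : Ω → Fin m → Fin n) : Prop where
  measurable : Measurable S
  indep : iIndepFun (fun (j : Fin m) (ω : Ω) => S ω j) P
  uniform : ∀ (j : Fin m) (i : Fin n), P {ω | S ω j = i} = (n : ℝ≥0∞)⁻¹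

end HessianSampling

end

/-!
The batch Hessian minus the full Hessian at a fixed point `y` is, up to the factor `1 / m`, the
deviation `Y` of a sum of `m` independent uniform draws from the self-adjoint operators
`∇²fᵢ(y)`, which have norm at most `L`, from its mean. The bound is therefore a matrix Hoeffding
inequality, and the proof is the method of exchangeable pairs applied to trace moments.

Let `Y'` be `Y` with one draw replaced by a fresh one, so that `‖Y - Y'‖ ≤ 2 L`. Exchangeability of
the pair `(Y, Y')` turns `E tr Y ^ (2 q + 2)` into a sum over the `m` draws of
`E tr ((Y - Y') (Y ^ (2 q + 1) - Y' ^ (2 q + 1))) / 2`, and the mean value trace inequality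
`LinearMap.IsSymmetric.trace_sub_mul_pow_sub_pow_le` bounds each term by
`(2 q + 1) / 2 * (2 L) ^ 2 * E tr Y ^ (2 q)`. The recursion
`deviationMoment_succ_le` shows that the moments are sub-Gaussian; summing them against the series
of `cosh` and applying Markov's inequality gives `card_lt_norm_sampleDeviation_le`. This needs no
inequality for traces of exponentials of sums, such as Golden–Thompson's, and the two-sided tail
comes at once because `cosh` is even.

Everything is done by counting samples in `Fin m → Fin n` at a fixed point. Since the batch is
independent of the random iterate and all `n ^ m` batches are equally likely,
`HessianSampling.IsUniformBatch.one_sub_le_of_card_le` transfers the count to the probability space;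
Hessians are measurable functions of the point because every `fderiv` is.
-/

/-! ### A trace inequality for powers of self-adjoint operators -/

theorem pow_mul_pow_add_pow_mul_pow_le {a b : ℝ} {i j : ℕ} (h : Even (i + j)) :
    a ^ i * b ^ j + a ^ j * b ^ i ≤ a ^ (i + j) + b ^ (i + j) := by
  have key : 0 ≤ (|a| ^ i - |b| ^ i) * (|a| ^ j - |b| ^ j) := by
    rcases le_total |a| |b| with hab | hab
    · exact mul_nonneg_of_nonpos_of_nonpos
        (sub_nonpos.2 (pow_le_pow_left₀ (abs_nonneg a) hab i))
        (sub_nonpos.2 (pow_le_pow_left₀ (abs_nonneg a) hab j))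
    · exact mul_nonneg
        (sub_nonneg.2 (pow_le_pow_left₀ (abs_nonneg b) hab i))
        (sub_nonneg.2 (pow_le_pow_left₀ (abs_nonneg b) hab j))
  have h₁ : a ^ i * b ^ j ≤ |a| ^ i * |b| ^ j := by
    rw [← abs_pow, ← abs_pow, ← abs_mul]; exact le_abs_self _
  have h₂ : a ^ j * b ^ i ≤ |a| ^ j * |b| ^ i := by
    rw [← abs_pow, ← abs_pow, ← abs_mul]; exact le_abs_self _
  rw [← h.pow_abs a, ← h.pow_abs b, pow_add, pow_add]
  linarith

/-- The scalar inequality behind `LinearMap.IsSymmetric.trace_sub_mul_pow_sub_pow_le`: the secant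
slope of an odd power is at most the average of the slopes at the two end points. -/
theorem sub_mul_pow_sub_pow_le (a b : ℝ) (q : ℕ) :
    (a - b) * (a ^ (2 * q + 1) - b ^ (2 * q + 1)) ≤
      (2 * q + 1 : ℕ) / 2 * ((a - b) ^ 2 * (a ^ (2 * q) + b ^ (2 * q))) := by
  rw [← geom_sum₂_mul]
  set G := ∑ i ∈ Finset.range (2 * q + 1), a ^ i * b ^ (2 * q + 1 - 1 - i) with hG
  have hG' : G = ∑ i ∈ Finset.range (2 * q + 1), a ^ (2 * q - i) * b ^ i := by
    rw [hG, ← Finset.sum_range_reflect]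
    refine Finset.sum_congr rfl fun i hi => ?_
    have := Finset.mem_range.1 hi
    congr 2; omega
  have h2 : G + G ≤ (2 * q + 1 : ℕ) * (a ^ (2 * q) + b ^ (2 * q)) := by
    nth_rewrite 2 [hG']
    rw [hG, ← Finset.sum_add_distrib]
    calc _ ≤ ∑ i ∈ Finset.range (2 * q + 1), (a ^ (2 * q) + b ^ (2 * q)) := by
          refine Finset.sum_le_sum fun i hi => ?_
          have := Finset.mem_range.1 hi
          have hs : i + (2 * q - i) = 2 * q := by omega
          have := pow_mul_pow_add_pow_mul_pow_le (a := a) (b := b) (i := i) (j := 2 * q - i)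
            (by rw [hs]; exact even_two_mul q)
          rw [hs] at this
          simpa using this
      _ = _ := by rw [Finset.sum_const, Finset.card_range, nsmul_eq_mul]
  nlinarith [mul_le_mul_of_nonneg_left h2 (sq_nonneg (a - b))]

section Trace

variable {E : Type*} [NormedAddCommGroup E] [InnerProductSpace ℝ E]

theorem LinearMap.pow_apply_of_apply_eq_smul {T : E →ₗ[ℝ] E} {a : ℝ} {v : E} (h : T v = a • v)
    (k : ℕ) : (T ^ k) v = a ^ k • v := by
  induction k with
  | zero => simp
  | succ k ih => rw [pow_succ, Module.End.mul_apply, h, map_smul, ih, smul_smul, pow_succ']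

variable [FiniteDimensional ℝ E] in
/-- Spectral theorem, in the form of an eigenbasis indexed by `Fin (finrank ℝ E)`. -/
theorem LinearMap.IsSymmetric.exists_eigenbasis {T : E →ₗ[ℝ] E} (hT : T.IsSymmetric) :
    ∃ (u : OrthonormalBasis (Fin (Module.finrank ℝ E)) ℝ E) (a : Fin (Module.finrank ℝ E) → ℝ),
      ∀ i, T (u i) = a i • u i :=
  ⟨hT.eigenvectorBasis rfl, hT.eigenvalues rfl, fun i => hT.apply_eigenvectorBasis rfl i⟩

theorem LinearMap.trace_pow_eq_sum {ι : Type*} [Fintype ι] {T : E →ₗ[ℝ] E} (u : OrthonormalBasis ι ℝ E)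
    {a : ι → ℝ} (h : ∀ i, T (u i) = a i • u i) (k : ℕ) :
    LinearMap.trace ℝ E (T ^ k) = ∑ i, a i ^ k := by
  rw [LinearMap.trace_eq_sum_inner _ u]
  refine Finset.sum_congr rfl fun i _ => ?_
  rw [LinearMap.pow_apply_of_apply_eq_smul (h i), inner_smul_right, real_inner_self_eq_norm_sq,
    u.norm_eq_one]
  simp

variable [FiniteDimensional ℝ E] in
/-- The mean value trace inequality for odd powers. In eigenbases `u` of `A` and `v` of `B`, with
eigenvalues `a` and `b`, both sides are sums over `i, j` weighted by `⟪v j, u i⟫ ^ 2`, and the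
inequality holds term by term. -/
theorem LinearMap.IsSymmetric.trace_sub_mul_pow_sub_pow_le {A B : E →ₗ[ℝ] E}
    (hA : A.IsSymmetric) (hB : B.IsSymmetric) {K : ℝ} (hK : ∀ x, ‖(A - B) x‖ ≤ K * ‖x‖) (q : ℕ) :
    LinearMap.trace ℝ E ((A - B) * (A ^ (2 * q + 1) - B ^ (2 * q + 1))) ≤
      (2 * q + 1 : ℕ) / 2 * (K ^ 2 *
        (LinearMap.trace ℝ E (A ^ (2 * q)) + LinearMap.trace ℝ E (B ^ (2 * q)))) := by
  obtain ⟨u, a, ha⟩ := hA.exists_eigenbasis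
  obtain ⟨v, b, hb⟩ := hB.exists_eigenbasis
  set D := A - B with hD
  have hDs : D.IsSymmetric := hA.sub hB
  have hent : ∀ k i j, inner ℝ (v j) ((A ^ k - B ^ k) (u i)) =
      (a i ^ k - b j ^ k) * inner ℝ (v j) (u i) := by
    intro k i j
    have hB' : inner ℝ (v j) ((B ^ k) (u i)) = b j ^ k * inner ℝ (v j) (u i) := by
      rw [← (hB.pow k) (v j) (u i), LinearMap.pow_apply_of_apply_eq_smul (hb j),
        real_inner_smul_left]
    rw [LinearMap.sub_apply, inner_sub_right, hB', LinearMap.pow_apply_of_apply_eq_smul (ha i),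
      inner_smul_right]
    simp only [sub_mul]
  have hentD : ∀ i j, inner ℝ (v j) (D (u i)) = (a i - b j) * inner ℝ (v j) (u i) := by
    intro i j
    simpa only [pow_one] using hent 1 i j
  have hsq : ∀ x : E, ‖x‖ = 1 → ‖D x‖ ^ 2 ≤ K ^ 2 := by
    intro x hx
    have := hK x
    rw [hx, mul_one] at this
    exact pow_le_pow_left₀ (norm_nonneg _) this 2
  have hl : LinearMap.trace ℝ E (D * (A ^ (2 * q + 1) - B ^ (2 * q + 1))) =
      ∑ i, ∑ j, (a i - b j) * (a i ^ (2 * q + 1) - b j ^ (2 * q + 1)) *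
        inner ℝ (v j) (u i) ^ 2 := by
    rw [LinearMap.trace_eq_sum_inner _ u]
    refine Finset.sum_congr rfl fun i _ => ?_
    rw [Module.End.mul_apply, ← hDs, ← v.sum_inner_mul_inner]
    refine Finset.sum_congr rfl fun j _ => ?_
    rw [hent, real_inner_comm, hentD]
    ring
  have hrA : ∑ i, ∑ j, (a i - b j) ^ 2 * a i ^ (2 * q) * inner ℝ (v j) (u i) ^ 2 ≤
      K ^ 2 * LinearMap.trace ℝ E (A ^ (2 * q)) := by
    rw [LinearMap.trace_pow_eq_sum u ha, Finset.mul_sum]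
    refine Finset.sum_le_sum fun i _ => ?_
    calc _ = ‖D (u i)‖ ^ 2 * a i ^ (2 * q) := by
          rw [← v.sum_sq_inner_right (D (u i)), Finset.sum_mul]
          refine Finset.sum_congr rfl fun j _ => ?_
          rw [hentD]; ring
      _ ≤ _ := mul_le_mul_of_nonneg_right (hsq _ (u.norm_eq_one i))
          ((even_two_mul q).pow_nonneg _)
  have hrB : ∑ i, ∑ j, (a i - b j) ^ 2 * b j ^ (2 * q) * inner ℝ (v j) (u i) ^ 2 ≤
      K ^ 2 * LinearMap.trace ℝ E (B ^ (2 * q)) := by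
    rw [LinearMap.trace_pow_eq_sum v hb, Finset.mul_sum, Finset.sum_comm]
    refine Finset.sum_le_sum fun j _ => ?_
    calc _ = ‖D (v j)‖ ^ 2 * b j ^ (2 * q) := by
          rw [← u.sum_sq_inner_right (D (v j)), Finset.sum_mul]
          refine Finset.sum_congr rfl fun i _ => ?_
          rw [← hDs, real_inner_comm (v j) (D (u i)), hentD]; ring
      _ ≤ _ := mul_le_mul_of_nonneg_right (hsq _ (v.norm_eq_one j))
          ((even_two_mul q).pow_nonneg _)
  rw [hl]
  calc _ ≤ ∑ i, ∑ j, (2 * q + 1 : ℕ) / 2 *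
        ((a i - b j) ^ 2 * a i ^ (2 * q) * inner ℝ (v j) (u i) ^ 2 +
          (a i - b j) ^ 2 * b j ^ (2 * q) * inner ℝ (v j) (u i) ^ 2) := by
        refine Finset.sum_le_sum fun i _ => Finset.sum_le_sum fun j _ => ?_
        refine (mul_le_mul_of_nonneg_right (sub_mul_pow_sub_pow_le (a i) (b j) q)
          (sq_nonneg (inner ℝ (v j) (u i)))).trans_eq ?_
        ring
    _ ≤ _ := by
        simp only [← Finset.mul_sum, Finset.sum_add_distrib]
        refine mul_le_mul_of_nonneg_left ?_ (by positivity)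
        linarith

/-- If `t < ‖Y‖` then some eigenvalue of `Y` exceeds `t` in absolute value, so the trace of
`cosh (θ Y)`, written here through the eigenvalues, is at least `cosh (θ t)`. -/
theorem cosh_le_sum_cosh_of_lt_opNorm {ι : Type*} [Fintype ι] {Y : E →L[ℝ] E}
    (u : OrthonormalBasis ι ℝ E) {a : ι → ℝ} (h : ∀ i, Y (u i) = a i • u i)
    (hY : (Y : E →ₗ[ℝ] E).IsSymmetric) {t : ℝ} (ht : 0 ≤ t) (htY : t < ‖Y‖) (θ : ℝ) :
    Real.cosh (θ * t) ≤ ∑ i, Real.cosh (θ * a i) := by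
  obtain ⟨i, hi⟩ : ∃ i, t < |a i| := by
    by_contra! hall
    refine htY.not_ge (Y.opNorm_le_bound ht fun x => ?_)
    refine le_of_sq_le_sq ?_ (by positivity)
    rw [mul_pow, ← u.sum_sq_inner_right (Y x), ← u.sum_sq_inner_right x, Finset.mul_sum]
    refine Finset.sum_le_sum fun i _ => ?_
    have : inner ℝ (u i) (Y x) = a i * inner ℝ (u i) x := by
      have := hY (u i) x
      simp only [ContinuousLinearMap.coe_coe] at this
      rw [← this, h, real_inner_smul_left]
    rw [this, mul_pow, ← sq_abs (a i)]
    exact mul_le_mul_of_nonneg_right (pow_le_pow_left₀ (abs_nonneg _) (hall i) 2) (sq_nonneg _)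
  calc Real.cosh (θ * t) ≤ Real.cosh (θ * a i) := by
        rw [Real.cosh_le_cosh, abs_mul, abs_mul, abs_of_nonneg ht]
        exact mul_le_mul_of_nonneg_left hi.le (abs_nonneg _)
    _ ≤ _ := Finset.single_le_sum (f := fun i => Real.cosh (θ * a i))
        (fun i _ => (Real.cosh_pos _).le) (Finset.mem_univ i)

end Trace

/-! ### Moments of the deviation of a uniform sample -/

section Moments

/-- The deviation `∑ j, (H (s j) - mean H)` of the sum of `H` over a sample `s` (drawn with
replacement, indexed by `κ`) from its expected value. -/
noncomputable def sampleDeviation {ι κ M : Type*} [Fintype ι] [Fintype κ] [AddCommGroup M]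
    [Module ℝ M] (H : ι → M) (s : κ → ι) : M :=
  ∑ j, (H (s j) - (Fintype.card ι : ℝ)⁻¹ • ∑ i, H i)

theorem map_sampleDeviation {ι κ M N : Type*} [Fintype ι] [Fintype κ] [AddCommGroup M]
    [Module ℝ M] [AddCommGroup N] [Module ℝ N] (φ : M →ₗ[ℝ] N) (H : ι → M) (s : κ → ι) :
    φ (sampleDeviation H s) = sampleDeviation (fun i => φ (H i)) s := by
  simp [sampleDeviation]

/-- Replacing the draw `j` by `i` changes the deviation by the difference of the two terms. -/
theorem sampleDeviation_sub_update {ι κ M : Type*} [Fintype ι] [Fintype κ] [DecidableEq κ]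
    [AddCommGroup M] [Module ℝ M] (H : ι → M) (s : κ → ι) (j : κ) (i : ι) :
    sampleDeviation H s - sampleDeviation H (Function.update s j i) = H (s j) - H i := by
  unfold sampleDeviation
  rw [← Finset.sum_sub_distrib, Finset.sum_eq_single j]
  · simp
  · intro k _ hk
    simp [Function.update_of_ne hk]
  · simp

/-- The exchangeable pair: swapping the draw `j` of a sample with a fresh draw. -/
def swapDraw {ι κ : Type*} [DecidableEq κ] (j : κ) : Equiv.Perm ((κ → ι) × ι) :=
  Function.Involutive.toPerm (fun z => (Function.update z.1 j z.2, z.1 j)) fun z => by simp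

variable {ι κ E : Type*} [Fintype ι] [Fintype κ] [NormedAddCommGroup E] [InnerProductSpace ℝ E]

theorem isSymmetric_sampleDeviation {H : ι → E →ₗ[ℝ] E} (hH : ∀ i, (H i).IsSymmetric)
    (s : κ → ι) : (sampleDeviation H s).IsSymmetric := by
  have hmean : (∑ i, H i).IsSymmetric :=
    Finset.sum_induction H _ (fun _ _ => LinearMap.IsSymmetric.add) LinearMap.IsSymmetric.zero
      fun i _ => hH i
  exact Finset.sum_induction _ _ (fun _ _ => LinearMap.IsSymmetric.add) LinearMap.IsSymmetric.zero
    fun j _ => (hH _).sub (hmean.smul (by simp))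

variable [FiniteDimensional ℝ E]

/-- The `2 p`-th moment of the deviation, summed (not averaged) over all samples. -/
noncomputable def deviationMoment (κ : Type*) [Fintype κ] [DecidableEq κ] (H : ι → E →ₗ[ℝ] E)
    (p : ℕ) : ℝ :=
  ∑ s : κ → ι, LinearMap.trace ℝ E (sampleDeviation H s ^ (2 * p))

variable [DecidableEq κ]

/-- The contribution of a single draw `j` to the moment of order `2 (q + 1)`. Averaging over a
fresh draw `i` turns the mean of `H` into `H i`, and exchanging the two draws antisymmetrizes the
sum, so that the mean value trace inequality applies. -/
theorem sum_trace_draw_mul_pow_le [Nonempty ι] {H : ι → E →ₗ[ℝ] E}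
    (hH : ∀ i, (H i).IsSymmetric) {K : ℝ} (hK : ∀ i i' x, ‖(H i - H i') x‖ ≤ K * ‖x‖) (q : ℕ)
    (j : κ) :
    ∑ s : κ → ι, LinearMap.trace ℝ E
        ((H (s j) - (Fintype.card ι : ℝ)⁻¹ • ∑ i, H i) * sampleDeviation H s ^ (2 * q + 1)) ≤
      (2 * q + 1 : ℕ) / 2 * (K ^ 2 * deviationMoment κ H q) := by
  set Y : (κ → ι) → E →ₗ[ℝ] E := sampleDeviation H with hY
  set c : ℝ := (Fintype.card ι : ℝ) with hc
  have hc0 : 0 < c := by rw [hc]; exact_mod_cast Fintype.card_pos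
  set g : (κ → ι) × ι → ℝ := fun z =>
    LinearMap.trace ℝ E ((H (z.1 j) - H z.2) * Y z.1 ^ (2 * q + 1)) with hg
  set r : (κ → ι) × ι → ℝ := fun z => LinearMap.trace ℝ E (Y z.1 ^ (2 * q)) with hr
  have hr_sum : ∑ z, r z = c * deviationMoment κ H q := by
    rw [Fintype.sum_prod_type, deviationMoment, Finset.mul_sum]
    simp [hr, hc, hY]
  have hleft : ∀ s : κ → ι, LinearMap.trace ℝ E
      ((H (s j) - c⁻¹ • ∑ i, H i) * Y s ^ (2 * q + 1)) = c⁻¹ * ∑ i, g (s, i) := by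
    intro s
    have : H (s j) - c⁻¹ • ∑ i, H i = c⁻¹ • ∑ i, (H (s j) - H i) := by
      rw [Finset.sum_sub_distrib, smul_sub, Finset.sum_const, Finset.card_univ,
        ← Nat.cast_smul_eq_nsmul ℝ, smul_smul, ← hc, inv_mul_cancel₀ hc0.ne', one_smul]
    rw [this, smul_mul_assoc, map_smul, Finset.sum_mul, map_sum, smul_eq_mul]
  have hswap : ∀ z, g z + g (swapDraw j z) ≤
      (2 * q + 1 : ℕ) / 2 * (K ^ 2 * (r z + r (swapDraw j z))) := by
    rintro ⟨s, i⟩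
    have hD : H (s j) - H i = Y s - Y (Function.update s j i) :=
      (sampleDeviation_sub_update H s j i).symm
    have := (isSymmetric_sampleDeviation hH s).trace_sub_mul_pow_sub_pow_le
      (isSymmetric_sampleDeviation hH (Function.update s j i)) (K := K)
      (by rw [sampleDeviation_sub_update]; exact hK _ _) q
    refine le_trans (le_of_eq ?_) this
    change LinearMap.trace ℝ E ((H (s j) - H i) * Y s ^ (2 * q + 1)) +
      LinearMap.trace ℝ E ((H (Function.update s j i j) - H (s j)) *
        Y (Function.update s j i) ^ (2 * q + 1)) = _
    rw [Function.update_self, sampleDeviation_sub_update, ← neg_sub (H (s j)) (H i), neg_mul,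
      map_neg, ← sub_eq_add_neg, ← map_sub, mul_sub]
  have hsum : ∑ z, g z ≤ (2 * q + 1 : ℕ) / 2 * (K ^ 2 * ∑ z, r z) := by
    have h := Finset.sum_le_sum fun z (_ : z ∈ Finset.univ) => hswap z
    rw [← Finset.mul_sum, ← Finset.mul_sum, Finset.sum_add_distrib, Finset.sum_add_distrib,
      Equiv.sum_comp (swapDraw j) g, Equiv.sum_comp (swapDraw j) r] at h
    linarith
  simp only [hleft]
  rw [← Finset.mul_sum, ← Fintype.sum_prod_type, inv_mul_le_iff₀ hc0]
  refine hsum.trans_eq ?_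
  rw [hr_sum]; ring

theorem deviationMoment_succ_le [Nonempty ι] {H : ι → E →ₗ[ℝ] E}
    (hH : ∀ i, (H i).IsSymmetric) {K : ℝ} (hK : ∀ i i' x, ‖(H i - H i') x‖ ≤ K * ‖x‖) (q : ℕ) :
    deviationMoment κ H (q + 1) ≤
      Fintype.card κ * ((2 * q + 1 : ℕ) / 2 * (K ^ 2 * deviationMoment κ H q)) := by
  have h : deviationMoment κ H (q + 1) = ∑ j : κ, ∑ s : κ → ι, LinearMap.trace ℝ E
      ((H (s j) - (Fintype.card ι : ℝ)⁻¹ • ∑ i, H i) * sampleDeviation H s ^ (2 * q + 1)) := by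
    rw [Finset.sum_comm, deviationMoment]
    refine Finset.sum_congr rfl fun s _ => ?_
    rw [← map_sum, ← Finset.sum_mul, show 2 * (q + 1) = 2 * q + 1 + 1 by ring, pow_succ']
    rfl
  rw [h]
  refine (Finset.sum_le_sum fun j _ => sum_trace_draw_mul_pow_le hH hK q j).trans_eq ?_
  rw [Finset.sum_const, Finset.card_univ, nsmul_eq_mul]

/-- Up to the factor counting dimensions and samples, the moments of the deviation are at most those
of a centred Gaussian of variance `card κ * K ^ 2 / 2`, whose `2 p`-th moment is
`(2 p)! / p! * (card κ * K ^ 2 / 4) ^ p`. -/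
theorem deviationMoment_le [Nonempty ι] {H : ι → E →ₗ[ℝ] E}
    (hH : ∀ i, (H i).IsSymmetric) {K : ℝ} (hK : ∀ i i' x, ‖(H i - H i') x‖ ≤ K * ‖x‖) (p : ℕ) :
    deviationMoment κ H p ≤ (2 * p).factorial / p.factorial * (Fintype.card κ * K ^ 2 / 4) ^ p *
      (Module.finrank ℝ E * Fintype.card ι ^ Fintype.card κ) := by
  induction p with
  | zero => simp [deviationMoment, mul_comm]
  | succ p ih =>
    refine (deviationMoment_succ_le hH hK p).trans ?_
    refine (mul_le_mul_of_nonneg_left (mul_le_mul_of_nonneg_left (mul_le_mul_of_nonneg_left ih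
      (sq_nonneg K)) (by positivity)) (by positivity)).trans_eq ?_
    rw [show 2 * (p + 1) = 2 * p + 1 + 1 by ring, Nat.factorial_succ (2 * p + 1),
      Nat.factorial_succ (2 * p), Nat.factorial_succ p, pow_succ]
    push_cast
    field_simp
    ring

/-! ### Exponential tail bound -/

/-- Matrix Hoeffding inequality, in counting form: the number of samples whose deviation exceeds
`t` in operator norm. -/
theorem card_lt_norm_sampleDeviation_le [Nonempty ι] {H : ι → E →L[ℝ] E}
    (hH : ∀ i, (H i : E →ₗ[ℝ] E).IsSymmetric) {K : ℝ} (hK : ∀ i i', ‖H i - H i'‖ ≤ K) {t : ℝ}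
    (ht : 0 ≤ t) (θ : ℝ) :
    (∑ s : κ → ι, if t < ‖sampleDeviation H s‖ then (1 : ℝ) else 0) ≤
      2 * Module.finrank ℝ E * Fintype.card ι ^ Fintype.card κ *
        Real.exp (θ ^ 2 * (Fintype.card κ * K ^ 2 / 4) - θ * t) := by
  set H' : ι → E →ₗ[ℝ] E := fun i => H i with hH'
  have hcoe : ∀ s : κ → ι, ((sampleDeviation H s : E →L[ℝ] E) : E →ₗ[ℝ] E) =
      sampleDeviation H' s := fun s =>
    map_sampleDeviation (ContinuousLinearMap.coeLM ℝ) H s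
  have hK' : ∀ i i' x, ‖(H' i - H' i') x‖ ≤ K * ‖x‖ := fun i i' x =>
    (H i - H i').le_of_opNorm_le (hK i i') x
  have hsymm : ∀ s : κ → ι, (sampleDeviation H' s).IsSymmetric := isSymmetric_sampleDeviation hH
  choose u a hua using fun s => (hsymm s).exists_eigenbasis
  set c : ℝ := Fintype.card κ * K ^ 2 / 4 with hc
  set N : ℝ := Module.finrank ℝ E * Fintype.card ι ^ Fintype.card κ with hN
  have hcosh : HasSum (fun p => θ ^ (2 * p) / (2 * p).factorial * deviationMoment κ H' p)
      (∑ s : κ → ι, ∑ k, Real.cosh (θ * a s k)) := by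
    have h : HasSum (fun p => ∑ s : κ → ι, ∑ k, (θ * a s k) ^ (2 * p) / (2 * p).factorial)
        (∑ s : κ → ι, ∑ k, Real.cosh (θ * a s k)) :=
      hasSum_sum fun s _ => hasSum_sum fun k _ => Real.hasSum_cosh _
    convert h using 2 with p
    rw [deviationMoment, Finset.mul_sum]
    refine Finset.sum_congr rfl fun s _ => ?_
    rw [LinearMap.trace_pow_eq_sum (u s) (hua s), Finset.mul_sum]
    refine Finset.sum_congr rfl fun k _ => ?_
    rw [mul_pow]; ring
  have hexp : HasSum (fun p : ℕ => (θ ^ 2 * c) ^ p / p.factorial * N)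
      (Real.exp (θ ^ 2 * c) * N) := by
    rw [Real.exp_eq_exp_ℝ]
    exact (NormedSpace.expSeries_div_hasSum_exp _).mul_right N
  have hmgf : ∑ s : κ → ι, ∑ k, Real.cosh (θ * a s k) ≤ Real.exp (θ ^ 2 * c) * N := by
    refine hasSum_le (fun p => ?_) hcosh hexp
    have hθ : 0 ≤ θ ^ (2 * p) := (even_two_mul p).pow_nonneg θ
    refine (mul_le_mul_of_nonneg_left (deviationMoment_le hH hK' p) (by positivity)).trans_eq ?_
    rw [mul_pow, ← pow_mul]
    rw [hc, hN]
    field_simp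
  have hmarkov : (∑ s : κ → ι, if t < ‖sampleDeviation H s‖ then (1 : ℝ) else 0) *
      Real.cosh (θ * t) ≤ ∑ s : κ → ι, ∑ k, Real.cosh (θ * a s k) := by
    rw [Finset.sum_mul]
    refine Finset.sum_le_sum fun s _ => ?_
    split_ifs with hs
    · rw [one_mul]
      refine cosh_le_sum_cosh_of_lt_opNorm (u s) (Y := sampleDeviation H s) (fun i => ?_) ?_ ht hs θ
      · rw [← hua s i, ← hcoe]; rfl
      · rw [hcoe]; exact hsymm s
    · rw [zero_mul]
      exact Finset.sum_nonneg fun k _ => (Real.cosh_pos _).le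
  have hcosh_ge : Real.exp (θ * t) / 2 ≤ Real.cosh (θ * t) := by
    rw [Real.cosh_eq]
    have := Real.exp_pos (-(θ * t))
    linarith
  rw [Real.exp_sub, ← mul_div_assoc, le_div_iff₀ (Real.exp_pos _)]
  have hnn : 0 ≤ ∑ s : κ → ι, if t < ‖sampleDeviation H s‖ then (1 : ℝ) else 0 :=
    Finset.sum_nonneg fun s _ => by split_ifs <;> norm_num
  have := mul_le_mul_of_nonneg_left hcosh_ge hnn
  calc _ ≤ 2 * (Real.exp (θ ^ 2 * c) * N) := by linarith
    _ = _ := by rw [hN]; ring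

end Moments

/-! ### Hessians -/

namespace HessianSampling

theorem norm_hessian_le {d : ℕ} {f : Space d → ℝ} {L : ℝ≥0} (h : LipschitzWith L (gradient f))
    (x : Space d) : ‖hessian f x‖ ≤ L :=
  norm_fderiv_le_of_lipschitz ℝ h

theorem measurable_hessian {d : ℕ} (f : Space d → ℝ) : Measurable (hessian f) :=
  measurable_fderiv ℝ (gradient f)

theorem isSymmetric_hessian {d : ℕ} {f : Space d → ℝ} (hf : TwiceDifferentiable f)
    (x : Space d) : (hessian f x : Space d →ₗ[ℝ] Space d).IsSymmetric := by
  have h₁ : ∀ y, HasFDerivAt f (fderiv ℝ f y) y := fun y => (hf.1 y).hasFDerivAt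
  set Φ : Space d →L[ℝ] Space d →L[ℝ] ℝ :=
    (isBoundedBilinearMap_inner (𝕜 := ℝ) (E := Space d)).toContinuousLinearMap with hΦ
  have hfd : fderiv ℝ f = fun y => Φ (gradient f y) := by
    ext y v
    change _ = inner ℝ (gradient f y) v
    simp [gradient]
  have h₂ : HasFDerivAt (fderiv ℝ f) (Φ.comp (hessian f x)) x := by
    rw [hfd]
    exact Φ.hasFDerivAt.comp x (hf.2 x).hasFDerivAt
  intro v w
  have := second_derivative_symmetric h₁ h₂ v w
  change inner ℝ (hessian f x v) w = inner ℝ (hessian f x w) v at this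
  rw [real_inner_comm v] at this
  exact this

theorem hessian_objective {n d : ℕ} {f : Fin n → Space d → ℝ}
    (hf : ∀ i, TwiceDifferentiable (f i)) (x : Space d) :
    hessian (objective f) x = (1 / (n : ℝ)) • ∑ i, hessian (f i) x := by
  have hg : gradient (objective f) = fun y => (1 / (n : ℝ)) • ∑ i, gradient (f i) y := by
    ext1 y
    have h : HasFDerivAt (objective f) ((1 / (n : ℝ)) • ∑ i, fderiv ℝ (f i) y) y := by
      unfold objective
      exact (HasFDerivAt.fun_sum fun i _ => ((hf i).1 y).hasFDerivAt).const_mul _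
    simp only [gradient, h.fderiv, map_smulₛₗ, map_sum]
    rfl
  unfold hessian
  rw [hg]
  have h : HasFDerivAt (fun y => ∑ i, gradient (f i) y) (∑ i, fderiv ℝ (gradient (f i)) x) x :=
    HasFDerivAt.fun_sum fun i _ => ((hf i).2 x).hasFDerivAt
  exact (h.const_smul (1 / (n : ℝ))).fderiv

/-! ### Reduction to a fixed point -/

/-- A uniform batch takes each of the `n ^ m` possible values with the same probability. -/
theorem IsUniformBatch.measure_eq {Ω : Type*} [MeasurableSpace Ω] {P : Measure Ω} {n m : ℕ}
    {S : Ω → Fin m → Fin n} (hS : IsUniformBatch P S) (s : Fin m → Fin n) :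
    P (S ⁻¹' {s}) = ((n : ℝ≥0∞)⁻¹) ^ m := by
  have h := hS.indep.measure_inter_preimage_eq_mul Finset.univ (sets := fun j => {s j})
    fun j _ => measurableSet_singleton _
  have hu : ∀ j, P ((fun ω => S ω j) ⁻¹' {s j}) = (n : ℝ≥0∞)⁻¹ := fun j => hS.uniform j (s j)
  simp only [hu, Finset.prod_const, Finset.card_univ, Fintype.card_fin] at h
  rw [← h]
  congr 1
  ext ω
  simp [funext_iff]

/-- If at every point `y` at most a fraction `δ` of all batches is bad, then a uniform batch is
bad at a random point independent of it with probability at most `δ`. -/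
theorem IsUniformBatch.one_sub_le_of_card_le {Ω : Type*} [MeasurableSpace Ω] {P : Measure Ω}
    [IsProbabilityMeasure P] {n m : ℕ} (hn : 0 < n) {S : Ω → Fin m → Fin n}
    (hS : IsUniformBatch P S) {X : Type*} [MeasurableSpace X] {x : Ω → X} (hx : Measurable x)
    (hxS : IndepFun x S P) (bad : (Fin m → Fin n) → Set X) (hbad : ∀ s, MeasurableSet (bad s))
    {δ : ℝ} (hcard : ∀ y, (∑ s, (bad s).indicator (fun _ => (1 : ℝ)) y) ≤ δ * n ^ m) :
    1 - δ ≤ P.real {ω | x ω ∉ bad (S ω)} := by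
  have hn' : (0 : ℝ) < (n : ℝ) ^ m := by positivity
  have hset : {ω | x ω ∉ bad (S ω)} = (⋃ s, (x ⁻¹' bad s ∩ S ⁻¹' {s}))ᶜ := by
    ext ω
    simp only [Set.mem_ofPred_eq, Set.mem_compl_iff, Set.mem_iUnion, Set.mem_inter_iff,
      Set.mem_preimage, Set.mem_singleton_iff, exists_eq_right']
  have hms : ∀ s, MeasurableSet (x ⁻¹' bad s ∩ S ⁻¹' {s}) := fun s =>
    (hx (hbad s)).inter (hS.measurable (measurableSet_singleton s))
  have hS' : ∀ s, P.real (S ⁻¹' {s}) = ((n : ℝ) ^ m)⁻¹ := fun s => by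
    rw [measureReal_def, hS.measure_eq]; simp
  have hint : ∫ ω, ∑ s, (bad s).indicator (fun _ => (1 : ℝ)) (x ω) ∂P =
      ∑ s, P.real (x ⁻¹' bad s) := by
    have hi : ∀ s, Integrable (fun ω => (bad s).indicator (fun _ => (1 : ℝ)) (x ω)) P :=
      fun s => (integrable_const (1 : ℝ)).indicator (hx (hbad s))
    rw [integral_finsetSum _ fun s _ => hi s]
    refine Finset.sum_congr rfl fun s _ => ?_
    exact integral_indicator_one (hx (hbad s))
  have hle : ∑ s, P.real (x ⁻¹' bad s) ≤ δ * n ^ m := by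
    rw [← hint]
    have := integral_mono_of_nonneg (μ := P)
      (f := fun ω => ∑ s, (bad s).indicator (fun _ => (1 : ℝ)) (x ω))
      (g := fun _ => δ * n ^ m)
      (Filter.Eventually.of_forall fun ω => Finset.sum_nonneg fun s _ =>
        Set.indicator_nonneg (fun _ _ => zero_le_one) _)
      (integrable_const _) (Filter.Eventually.of_forall fun ω => hcard (x ω))
    simpa using this
  rw [hset, probReal_compl_eq_one_sub (MeasurableSet.iUnion hms)]
  refine sub_le_sub_left ?_ _
  calc P.real (⋃ s, (x ⁻¹' bad s ∩ S ⁻¹' {s}))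
      ≤ ∑ s, P.real (x ⁻¹' bad s ∩ S ⁻¹' {s}) := measureReal_iUnion_fintype_le _
    _ = ∑ s, P.real (x ⁻¹' bad s) * ((n : ℝ) ^ m)⁻¹ := by
        refine Finset.sum_congr rfl fun s _ => ?_
        rw [← hS' s, measureReal_def, hxS.measure_inter_preimage_eq_mul _ _ (hbad s)
          (measurableSet_singleton s), ENNReal.toReal_mul]
        rfl
    _ ≤ δ := by
        rw [← Finset.sum_mul, ← div_eq_mul_inv, div_le_iff₀ hn']
        exact hle

end HessianSampling

/-! ### The sampling bound -/

namespace HessianSampling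

theorem batchHessian_sub_hessian_objective {n d m : ℕ} (hm : 0 < m)
    {f : Fin n → Space d → ℝ} (hf : ∀ i, TwiceDifferentiable (f i)) (s : Fin m → Fin n)
    (y : Space d) :
    batchHessian f s y - hessian (objective f) y =
      (1 / (m : ℝ)) • sampleDeviation (fun i => hessian (f i) y) s := by
  have hm' : (m : ℝ) ≠ 0 := by positivity
  rw [hessian_objective hf, batchHessian, sampleDeviation, Finset.sum_sub_distrib,
    Finset.sum_const, Finset.card_univ, Fintype.card_fin, Fintype.card_fin, smul_sub,
    ← Nat.cast_smul_eq_nsmul ℝ m, smul_smul (1 / (m : ℝ)) (m : ℝ), one_div_mul_cancel hm',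
    one_smul, one_div (n : ℝ)]

/-- The tail bound at a fixed point, with the optimal parameter `θ = ε / (2 L ^ 2)`. The hypothesis
on `m` makes the exponent at most `-4 log (2 d / δ)`, while `-log (2 d / δ)` is enough. -/
theorem card_bad_batch_le {n d m : ℕ} (hn : 0 < n) (hd : 0 < d) {f : Fin n → Space d → ℝ}
    {L : ℝ≥0} (hL0 : 0 < L) (hf : ∀ i, TwiceDifferentiable (f i))
    (hL : ∀ i, LipschitzWith L (gradient (f i))) {ε δ : ℝ} (hε : 0 < ε) (hδ : 0 < δ)
    (hδ1 : δ < 1) (hm : 16 * (L : ℝ) ^ 2 * Real.log (2 * (d : ℝ) / δ) / ε ^ 2 ≤ m)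
    (y : Space d) :
    (∑ s : Fin m → Fin n,
      if ε < ‖batchHessian f s y - hessian (objective f) y‖ then (1 : ℝ) else 0) ≤
      δ * n ^ m := by
  have hL0' : (0 : ℝ) < L := hL0
  have hd1 : (1 : ℝ) ≤ d := by exact_mod_cast hd
  have hlog : 0 < Real.log (2 * (d : ℝ) / δ) :=
    Real.log_pos ((one_lt_div hδ).2 (by linarith))
  have hm0 : 0 < m := by
    have : (0 : ℝ) < m := lt_of_lt_of_le (by positivity) hm
    exact_mod_cast this
  have hm0' : (0 : ℝ) < m := by exact_mod_cast hm0
  have : Nonempty (Fin n) := ⟨⟨0, hn⟩⟩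
  have hnorm : ∀ s : Fin m → Fin n, ε < ‖batchHessian f s y - hessian (objective f) y‖ ↔
      m * ε < ‖sampleDeviation (fun i => hessian (f i) y) s‖ := fun s => by
    rw [batchHessian_sub_hessian_objective hm0 hf, norm_smul, Real.norm_of_nonneg (by positivity),
      one_div, ← div_eq_inv_mul, lt_div_iff₀' hm0']
  have htail := card_lt_norm_sampleDeviation_le (κ := Fin m) (H := fun i => hessian (f i) y)
    (fun i => isSymmetric_hessian (hf i) y) (K := 2 * L)
    (fun i i' => (norm_sub_le _ _).trans (by
      have h₁ := norm_hessian_le (hL i) y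
      have h₂ := norm_hessian_le (hL i') y
      linarith)) (t := m * ε) (by positivity) (ε / (2 * (L : ℝ) ^ 2))
  simp only [hnorm]
  refine htail.trans ?_
  rw [finrank_euclideanSpace_fin, Fintype.card_fin, Fintype.card_fin]
  have hexpo : (ε / (2 * (L : ℝ) ^ 2)) ^ 2 * (m * (2 * L) ^ 2 / 4) -
      ε / (2 * (L : ℝ) ^ 2) * (m * ε) ≤ -Real.log (2 * (d : ℝ) / δ) := by
    have h₁ : (ε / (2 * (L : ℝ) ^ 2)) ^ 2 * (m * (2 * L) ^ 2 / 4) -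
        ε / (2 * (L : ℝ) ^ 2) * (m * ε) = -(m * ε ^ 2 / (4 * L ^ 2)) := by
      field_simp; ring
    have h₂ : 4 * Real.log (2 * (d : ℝ) / δ) ≤ m * ε ^ 2 / (4 * L ^ 2) := by
      rw [div_le_iff₀ (by positivity)] at hm
      rw [le_div_iff₀ (by positivity)]
      linarith
    linarith
  have hd0 : (0 : ℝ) < d := by linarith
  calc _ ≤ 2 * (d : ℝ) * n ^ m * Real.exp (-Real.log (2 * (d : ℝ) / δ)) := by gcongr
    _ = δ * n ^ m := by
        rw [Real.exp_neg, Real.exp_log (by positivity)]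
        field_simp

end HessianSampling

theorem theorem2 {n d : ℕ} (hn : 0 < n)
    -- the component functions, with `L₁`-Lipschitz gradients
    (f : Fin n → HessianSampling.Space d → ℝ) (L₁ : ℝ≥0)
    (hf : ∀ i, HessianSampling.TwiceDifferentiable (f i))
    (hL : ∀ i, LipschitzWith L₁ (gradient (f i)))
    -- accuracy and failure probability
    (ε δ : ℝ) (hε : 0 < ε) (hδ : 0 < δ) (hδ1 : δ < 1)
    {Ω : Type*} [MeasurableSpace Ω] (P : Measure Ω) [IsProbabilityMeasure P]
    -- random iterates `x t` and random Hessian batches `S t` of `m t` draws;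
    -- each batch is drawn independently of the iterate at which it is used
    (m : ℕ → ℕ) (x : ℕ → Ω → HessianSampling.Space d) (S : (t : ℕ) → Ω → Fin (m t) → Fin n)
    (hx : ∀ t, Measurable (x t))
    (hS : ∀ t, HessianSampling.IsUniformBatch P (S t))
    (hxS : ∀ t, IndepFun (x t) (S t) P) :
    ∀ t : ℕ, 16 * (L₁ : ℝ) ^ 2 * Real.log (2 * (d : ℝ) / δ) / ε ^ 2 ≤ (m t : ℝ) →
      1 - δ ≤ P.real {ω | ‖HessianSampling.batchHessian f (S t ω) (x t ω)
        - HessianSampling.hessian (HessianSampling.objective f) (x t ω)‖ ≤ ε} := by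
  intro t hm
  by_cases h0 : d = 0 ∨ L₁ = 0
  · -- All Hessians vanish; here `m t = 0` is possible, and the estimator is then `0` as well.
    have hz : ∀ (i : Fin n) (y : HessianSampling.Space d), HessianSampling.hessian (f i) y = 0 := by
      intro i y
      rcases h0 with rfl | rfl
      · exact Subsingleton.elim _ _
      · simpa using HessianSampling.norm_hessian_le (hL i) y
    have huniv : {ω | ‖HessianSampling.batchHessian f (S t ω) (x t ω)
        - HessianSampling.hessian (HessianSampling.objective f) (x t ω)‖ ≤ ε} = Set.univ := by
      refine Set.eq_univ_of_forall fun ω => ?_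
      rw [Set.mem_ofPred_eq, HessianSampling.hessian_objective hf, HessianSampling.batchHessian]
      simpa [hz] using hε.le
    rw [huniv, probReal_univ]
    linarith
  · obtain ⟨hd, hL0⟩ := not_or.1 h0
    have hmeas : ∀ s : Fin (m t) → Fin n, MeasurableSet {y | ε <
        ‖HessianSampling.batchHessian f s y
          - HessianSampling.hessian (HessianSampling.objective f) y‖} := by
      intro s
      refine measurableSet_lt measurable_const (Measurable.norm (Measurable.sub ?_
        (HessianSampling.measurable_hessian _)))
      have hsum : Measurable fun y => ∑ j, HessianSampling.hessian (f (s j)) y :=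
        Finset.measurable_fun_sum _ fun j _ => HessianSampling.measurable_hessian (f (s j))
      exact hsum.const_smul (1 / (m t : ℝ))
    have h := (hS t).one_sub_le_of_card_le hn (hx t) (hxS t) _ hmeas (δ := δ) fun y => by
      simpa [Set.indicator_apply] using HessianSampling.card_bad_batch_le hn
        (Nat.pos_of_ne_zero hd) (pos_iff_ne_zero.2 hL0) hf hL hε hδ hδ1 hm y
    simpa only [Set.mem_ofPred_eq, not_lt] using h
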